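/- **Theorem (fundamental theorem of differential tropical geometry).** Let $K$ be an uncountable algebraically closed field of characteristic zero and let $R=K[[t]]$ with the derivation $d=\frac{d}{dt}$. Let $R\{x_1,\dots,x_n\}$ be the ring of differential polynomials, i.e. the polynomial ring over $R$ in the variables $x_{ij}$ ($1\le i\le n$, $j\ge 0$), with the derivation extending $d$ by $d(x_{ij})=x_{i(j+1)}$. Let $G$ be a differential ideal of it, i.e. an ideal with $d(G)\subseteq G$. Then $$\mathrm{Sol}(\mathrm{trop}(G))=\mathrm{trop}(\mathrm{Sol}(G))\subseteq\mathcal P(\mathbb Z_{\ge 0})^n ,$$ where the following notation is used. * $\mathrm{Sol}(G)$ is the set of $\varphi=(\varphi_1,\dots,\varphi_n)\in R^n$ such that $P(\varphi):=P|_{x_{ij}=d^j\varphi_i}=0$ for all $P\in G$, and $\mathrm{trop}(\mathrm{Sol}(G))$ is the set of the tuples $(\mathrm{Supp}(\varphi_1),\dots,\mathrm{Supp}(\varphi_n))$ with $\varphi\in\mathrm{Sol}(G)$, where $\mathrm{Supp}(\sum_k a_kt^k)=\{k: a_k\neq 0\}$. * For $S\subseteq\mathbb Z_{\ge 0}$ and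 $j\ge 0$, $\mathrm{Val}_S(j)=\min\{s\in S: s\ge j\}-j$, or $\infty$ if $S$ has no element $\ge j$. For $S=(S_1,\dots,S_n)\in\mathcal P(\mathbb Z_{\ge 0})^n$ and a finitely supported matrix $M=(M_{ij})$ of nonnegative integers, $\varepsilon_M(S)=\sum_{i,j}M_{ij}\,\mathrm{Val}_{S_i}(j)$, with $0\cdot\infty=0$. * A tropical differential polynomial $\phi=\bigoplus_{M\in\Lambda}a_M\odot\varepsilon_M$ ($\Lambda$ a finite set of such matrices, $a_M\in\mathbb Z_{\ge 0}\cup\{\infty\}$, with $\oplus=\min$ and $\odot=+$) has the value $\phi(S)=\min_{M\in\Lambda}(a_M+\varepsilon_M(S))$ at $S$ (equal to $\infty$ if $\Lambda=\emptyset$). The tuple $S$ is a solution of $\phi$ if $\phi(S)=\infty$ or if the minimum is attained for at least two different $M\in\Lambda$. * For $P=\sum_{M\in\Lambda}\psi_M\prod_{i,j}x_{ij}^{M_{ij}}$ with $\psi_M\in R$, $\mathrm{trop}(P)=\bigoplus_{M\in\Lambda}\mathrm{val}(\psi_M)\odot\varepsilon_M$, where $\mathrm{val}$ is the $t$-adic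 valuation; $\mathrm{trop}(G)=\{\mathrm{trop}(P): P\in G\}$; and $\mathrm{Sol}(\mathrm{trop}(G))$ is the set of $S\in\mathcal P(\mathbb Z_{\ge 0})^n$ that are solutions of $\mathrm{trop}(P)$ for all $P\in G$. In words: the $n$-tuples of subsets of $\mathbb Z_{\ge 0}$ that solve every tropicalized polynomial $\mathrm{trop}(P)$, $P\in G$, are exactly the support tuples of the power-series solutions of $G$. -/

import Mathlib

namespace DiffTrop

open MvPolynomial

noncomputable section

/-! ### Differential polynomials -/

/-- The ring `R{x_1, …, x_n}` of differential polynomials: polynomials over `R` in the variables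
`x_{ij}`, where `i` runs over `n` indices and `j ≥ 0` is the order of derivation. -/
abbrev DiffPoly (n : ℕ) (R : Type*) [CommSemiring R] : Type _ := MvPolynomial (Fin n × ℕ) R

section Deriv

variable {k R : Type*} [CommRing k] [CommRing R] [Algebra k R]

/-- Coefficientwise application of a derivation of `R` to polynomials over `R`, as a linear map. -/
def coeffwiseLin (δ : Derivation k R R) (σ : Type*) : MvPolynomial σ R →ₗ[k] MvPolynomial σ R where
  toFun P := ∑ M ∈ P.support, monomial M (δ (coeff M P))
  map_add' P Q := by
    classical
    ext M
    simp only [coeff_sum, coeff_monomial, coeff_add, Finset.sum_ite_eq', mem_support_iff]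
    split_ifs <;> simp_all [← map_add]
  map_smul' c P := by
    classical
    ext M
    simp only [coeff_sum, coeff_monomial, coeff_smul, Finset.sum_ite_eq', mem_support_iff,
      RingHom.id_apply]
    split_ifs with h₁ h₂ h₂
    · simp
    · simp_all
    · rw [← Derivation.map_smul, not_not.mp h₁, map_zero]
    · simp

theorem coeffwiseLin_monomial (δ : Derivation k R R) {σ : Type*} (M : σ →₀ ℕ) (a : R) :
    coeffwiseLin δ σ (monomial M a) = monomial M (δ a) := by
  classical
  ext N
  simp only [coeffwiseLin, LinearMap.coe_mk, AddHom.coe_mk, coeff_sum, coeff_monomial,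
    Finset.sum_ite_eq', mem_support_iff]
  split_ifs <;> simp_all

/-- Coefficientwise application of a derivation of `R` to polynomials over `R`; it is a derivation
which kills the variables. -/
def coeffwise (δ : Derivation k R R) (σ : Type*) :
    Derivation k (MvPolynomial σ R) (MvPolynomial σ R) :=
  Derivation.mk' (coeffwiseLin δ σ) fun P Q => by
    induction P using MvPolynomial.induction_on' with
    | add P₁ P₂ h₁ h₂ => simp only [add_mul, map_add, h₁, h₂, smul_eq_mul]; ring
    | monomial M a =>
      induction Q using MvPolynomial.induction_on' with
      | add Q₁ Q₂ h₁ h₂ =>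
        simp only [mul_add, map_add, h₁, h₂, smul_eq_mul]; ring
      | monomial N b =>
        simp only [monomial_mul, coeffwiseLin_monomial, smul_eq_mul, Derivation.leibniz, map_add,
          add_comm N M, mul_comm b]

/-- The derivation `d` of `R{x_1, …, x_n}` which extends the derivation `δ` of `R` and satisfies
`d x_{ij} = x_{i(j+1)}`. -/
def polyDeriv (δ : Derivation k R R) (n : ℕ) : Derivation k (DiffPoly n R) (DiffPoly n R) :=
  coeffwise δ (Fin n × ℕ) +
    (mkDerivation R fun v : Fin n × ℕ => (X (v.1, v.2 + 1) : DiffPoly n R)).restrictScalars k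

theorem polyDeriv_C (δ : Derivation k R R) (n : ℕ) (a : R) : polyDeriv δ n (C a) = C (δ a) := by
  simpa [polyDeriv, coeffwise] using coeffwiseLin_monomial δ (0 : Fin n × ℕ →₀ ℕ) a

theorem polyDeriv_X (δ : Derivation k R R) (n : ℕ) (i : Fin n) (j : ℕ) :
    polyDeriv δ n (X (i, j)) = X (i, j + 1) := by
  have h : coeffwiseLin δ (Fin n × ℕ) (X (i, j)) = 0 := by
    rw [X, coeffwiseLin_monomial, Derivation.map_one_eq_zero, map_zero]
  simp [polyDeriv, coeffwise, h, mkDerivation_X]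

/-- An ideal of the ring of differential polynomials is differential if it is stable under `d`. -/
def IsDifferentialIdeal (δ : Derivation k R R) {n : ℕ} (G : Ideal (DiffPoly n R)) : Prop :=
  ∀ P ∈ G, polyDeriv δ n P ∈ G

/-- The value `P(φ) = P|_{x_{ij} = d^j φ_i}` of a differential polynomial at `φ ∈ R^n`. -/
def value (δ : Derivation k R R) {n : ℕ} (φ : Fin n → R) (P : DiffPoly n R) : R :=
  MvPolynomial.eval (fun v : Fin n × ℕ => (⇑δ)^[v.2] (φ v.1)) P

/-- The set of solutions in `R^n` of a system of differential polynomials. -/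
def Sol (δ : Derivation k R R) {n : ℕ} (T : Set (DiffPoly n R)) : Set (Fin n → R) :=
  {φ | ∀ P ∈ T, value δ φ P = 0}

end Deriv

/-! ### Tropical differential polynomials -/

/-- The support of a power series. -/
def supp {K : Type*} [Semiring K] (φ : PowerSeries K) : Set ℕ :=
  {i | PowerSeries.coeff i φ ≠ 0}

/-- The tropicalization `(Supp φ_1, …, Supp φ_n)` of an `n`-tuple of power series. -/
def tropTuple {K : Type*} [Semiring K] {n : ℕ} (φ : Fin n → PowerSeries K) : Fin n → Set ℕ :=
  fun i => supp (φ i)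

open Classical in
/-- `Val_S(j) = min {s ∈ S : s ≥ j} - j`, and `∞` if `S` has no element `≥ j`. -/
def Val (S : Set ℕ) (j : ℕ) : ℕ∞ :=
  if (S ∩ Set.Ici j).Nonempty then ((sInf (S ∩ Set.Ici j) - j : ℕ) : ℕ∞) else ⊤

/-- Tropical differential polynomials in `n` variables: polynomials in the variables `x_{ij}` over
the semiring `𝕋 = (ℤ_{≥0} ∪ {∞}, min, +)`, whose zero element is `∞`. -/
abbrev TropDiffPoly (n : ℕ) : Type := DiffPoly n (Tropical ℕ∞)

/-- The value `∑_{i,j} M_{ij} · Val_{S_i}(j)` of the tropical differential monomial with exponent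
matrix `M` at `S` (with `0 · ∞ = 0`). -/
def tropMonomialValue {n : ℕ} (S : Fin n → Set ℕ) (M : Fin n × ℕ →₀ ℕ) : ℕ∞ :=
  ∑ v ∈ M.support, (M v : ℕ∞) * Val (S v.1) v.2

/-- The value `a_M + ε_M(S)` at `S` of the term of `f` with exponent matrix `M`. -/
def termValue {n : ℕ} (f : TropDiffPoly n) (S : Fin n → Set ℕ) (M : Fin n × ℕ →₀ ℕ) : ℕ∞ :=
  Tropical.untrop (coeff M f) + tropMonomialValue S M

/-- The value `min_M (a_M + ε_M(S))` of a tropical differential polynomial at `S`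
(the minimum over the empty set of terms being `∞`). -/
def tropValue {n : ℕ} (f : TropDiffPoly n) (S : Fin n → Set ℕ) : ℕ∞ :=
  f.support.inf fun M => termValue f S M

/-- `S` is a solution of `f` if the minimum is attained at two different monomials or is `∞`. -/
def IsTropSolution {n : ℕ} (f : TropDiffPoly n) (S : Fin n → Set ℕ) : Prop :=
  (∃ M₁ ∈ f.support, ∃ M₂ ∈ f.support, M₁ ≠ M₂ ∧
      tropValue f S = termValue f S M₁ ∧ tropValue f S = termValue f S M₂) ∨
    tropValue f S = ⊤

/-- The set of solutions of a family of tropical differential polynomials. -/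
def TropSol {n : ℕ} (H : Set (TropDiffPoly n)) : Set (Fin n → Set ℕ) :=
  {S | ∀ f ∈ H, IsTropSolution f S}

/-- The tropicalization `⨁_M val(ψ_M) ⊙ ε_M` of the differential polynomial `∑_M ψ_M E_M` over the
ring of power series. -/
def tropPoly {K : Type*} [CommRing K] {n : ℕ} (P : DiffPoly n (PowerSeries K)) : TropDiffPoly n :=
  ∑ M ∈ P.support, monomial M (Tropical.trop (PowerSeries.order (coeff M P)))

end

end DiffTrop

namespace DiffTrop

open MvPolynomial

/-! ### The Nullstellensatz in countably many variables -/

section Nullstellensatz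

variable {K : Type*} [Field K]

/-! A support tuple solves `trop(P)` when `P(φ) = 0` because the lowest-order terms of a vanishing
sum of power series must cancel: a finite minimal order is attained twice.

For the converse, write `φ_i = ∑ a_{ij} t^j / j!`. The constant term of `P(φ)` is then `P` mod `t`
evaluated at `a`. As `G` is stable under `d` and the characteristic is zero, these constant terms
control all coefficients, so `φ` solves `G` iff `a` is a zero of `G` mod `t`. What is needed is such
a zero with `a_{ij} ≠ 0` exactly for `j ∈ S_i`. The Nullstellensatz in countably many variables,
which uses that `K` is uncountable, gives one (`exists_zero_of_forall_monomial_notMem`) unless `G`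
mod `t` together with the `x_{ij}`, `j ∉ S_i`, generates an ideal containing a monomial in the
remaining variables. In that case some `P ∈ G` has exactly one term of value `0` at `S`, so `S` does
not solve `trop(P)` (`not_isTropSolution_of_unique`). -/

/-- A field extension of countable dimension over an uncountable field is algebraic. -/
theorem isAlgebraic_of_span_countable [Uncountable K] {E : Type*} [Field E] [Algebra K E]
    {s : Set E} (hs : s.Countable) (hspan : Submodule.span K s = ⊤) : Algebra.IsAlgebraic K E := by
  refine ⟨fun x => ?_⟩
  by_contra hx
  -- For transcendental `x` the elements `1/(x - c)`, `c ∈ K`, are linearly independent, so the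
  -- dimension is at least the cardinality of `K`.
  have h₁ := (show Transcendental K x from hx).linearIndependent_sub_inv.cardinal_lift_le_rank
  have h₂ : Module.rank K E ≤ Cardinal.aleph0 := by
    rw [← rank_top, ← hspan]
    exact (rank_span_le s).trans (Cardinal.mk_le_aleph0_iff.mpr hs.to_subtype)
  have h₃ := h₁.trans (Cardinal.lift_le.mpr h₂)
  rw [Cardinal.lift_aleph0, Cardinal.lift_le_aleph0, Cardinal.mk_le_aleph0_iff] at h₃
  exact not_countable h₃

/-- The submonoid of the monomials in the variables of `S`. -/
def monomialsIn (K : Type*) [Field K] {σ : Type*} (S : Set σ) : Submonoid (MvPolynomial σ K) where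
  carrier := {p | ∃ M : σ →₀ ℕ, (∀ v ∈ M.support, v ∈ S) ∧ monomial M 1 = p}
  one_mem' := ⟨0, by simp, rfl⟩
  mul_mem' := by
    classical
    rintro _ _ ⟨M, hM, rfl⟩ ⟨N, hN, rfl⟩
    refine ⟨M + N, fun v hv => ?_, by simp [monomial_mul]⟩
    exact (Finset.mem_union.mp (Finsupp.support_add hv)).elim (hM v) (hN v)

theorem countable_monomialsIn {σ : Type*} [Countable σ] (S : Set σ) :
    Countable (monomialsIn K S) :=
  (Set.countable_range fun M : σ →₀ ℕ => (monomial M (1 : K))).mono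
    (by rintro _ ⟨M, -, rfl⟩; exact ⟨M, rfl⟩) |>.to_subtype

/-- This spanning family is countable as soon as `σ` and `T` are. -/
theorem span_mk'_monomial {σ : Type*} (T : Submonoid (MvPolynomial σ K)) :
    Submodule.span K (Set.range fun p : (σ →₀ ℕ) × T =>
      IsLocalization.mk' (Localization T) (monomial p.1 (1 : K)) p.2) = ⊤ := by
  rw [eq_top_iff]
  rintro z -
  obtain ⟨p, s, rfl⟩ := IsLocalization.exists_mk'_eq T z
  rw [IsLocalization.mk'_eq_mul_mk'_one]
  induction p using MvPolynomial.induction_on' with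
  | monomial M a =>
    have : algebraMap _ (Localization T) (monomial M a) =
        a • algebraMap _ (Localization T) (monomial M (1 : K)) := by
      have := map_smul (Algebra.algHom K _ (Localization T)) a (monomial M (1 : K))
      rwa [smul_monomial, smul_eq_mul, mul_one] at this
    rw [this, smul_mul_assoc, ← IsLocalization.mk'_eq_mul_mk'_one]
    exact Submodule.smul_mem _ _ (Submodule.subset_span ⟨(M, s), rfl⟩)
  | add p q hp hq =>
    rw [map_add, add_mul]
    exact add_mem hp hq

/-- A nontrivial algebra of countable dimension over an uncountable algebraically closed field has
a rational point. -/
theorem exists_algHom_of_span_countable [IsAlgClosed K] [Uncountable K] {A : Type*} [CommRing A]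
    [Nontrivial A] [Algebra K A] {s : Set A} (hs : s.Countable)
    (hspan : Submodule.span K s = ⊤) : Nonempty (A →ₐ[K] K) := by
  obtain ⟨m, hm⟩ := Ideal.exists_maximal A
  let : Field (A ⧸ m) := Ideal.Quotient.field m
  -- The residue field inherits a countable spanning set, so it is algebraic over `K` and embeds in
  -- it.
  have : Algebra.IsAlgebraic K (A ⧸ m) := by
    refine isAlgebraic_of_span_countable (hs.image (Ideal.Quotient.mkₐ K m).toLinearMap) ?_
    rw [← Submodule.map_span, hspan, Submodule.map_top, LinearMap.range_eq_top]
    exact Ideal.Quotient.mkₐ_surjective K m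
  exact ⟨(IsAlgClosed.lift (M := K) (R := K) (S := A ⧸ m)).comp (Ideal.Quotient.mkₐ K m)⟩

/-- Over an uncountable algebraically closed field, an ideal in countably many variables which
contains no monomial in the variables of `S` has a zero at which no variable of `S` vanishes. -/
theorem exists_zero_of_forall_monomial_notMem [IsAlgClosed K] [Uncountable K] {σ : Type*}
    [Countable σ] (J : Ideal (MvPolynomial σ K)) (S : Set σ)
    (h : ∀ M : σ →₀ ℕ, (∀ v ∈ M.support, v ∈ S) → monomial M 1 ∉ J) :
    ∃ a : σ → K, (∀ p ∈ J, eval a p = 0) ∧ ∀ v ∈ S, a v ≠ 0 := by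
  let T := monomialsIn K S
  have hdisj : Disjoint (T : Set (MvPolynomial σ K)) J := by
    rw [Set.disjoint_left]
    rintro _ ⟨M, hM, rfl⟩
    exact h M hM
  -- Inverting the variables of `S` forces their images under any point to be units; the localized
  -- ideal stays proper by disjointness.
  let I := J.map (algebraMap _ (Localization T))
  have : Nontrivial (Localization T ⧸ I) := Ideal.Quotient.nontrivial_iff.mpr
    ((IsLocalization.map_algebraMap_ne_top_iff_disjoint T (Localization T) J).mpr hdisj)
  have : Countable T := countable_monomialsIn S
  let π : Localization T →ₐ[K] Localization T ⧸ I := Ideal.Quotient.mkₐ K I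
  obtain ⟨f⟩ := exists_algHom_of_span_countable
    ((Set.countable_range fun p : (σ →₀ ℕ) × T =>
      IsLocalization.mk' (Localization T) (monomial p.1 (1 : K)) p.2).image π.toLinearMap) <| by
    rw [← Submodule.map_span, span_mk'_monomial, Submodule.map_top, LinearMap.range_eq_top]
    exact Ideal.Quotient.mkₐ_surjective K I
  let g : Localization T →ₐ[K] K := f.comp π
  let ρ : MvPolynomial σ K →ₐ[K] K := g.comp (Algebra.algHom K _ (Localization T))
  have hρ : ∀ p, eval (fun v => ρ (X v)) p = ρ p := by
    intro p
    rw [← coe_aeval_eq_eval]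
    exact DFunLike.congr_fun (aeval_unique ρ).symm p
  refine ⟨fun v => ρ (X v), fun p hp => ?_, fun v hv => ?_⟩
  · rw [hρ]
    change f (Ideal.Quotient.mk I (algebraMap _ _ p)) = 0
    rw [Ideal.Quotient.eq_zero_iff_mem.mpr (Ideal.mem_map_of_mem _ hp), map_zero]
  · refine IsUnit.ne_zero
      (IsUnit.map g (IsLocalization.map_units (Localization T) (⟨X v, ?_⟩ : T)))
    refine ⟨Finsupp.single v 1, fun w hw => ?_, rfl⟩
    rwa [Finset.mem_singleton.mp (Finsupp.support_single_subset hw)]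

end Nullstellensatz

/-! ### Values of differential polynomials -/

section Value

variable {k R : Type*} [CommRing k] [CommRing R] [Algebra k R]

theorem value_polyDeriv (δ : Derivation k R R) {n : ℕ} (φ : Fin n → R) (P : DiffPoly n R) :
    value δ φ (polyDeriv δ n P) = δ (value δ φ P) := by
  induction P using MvPolynomial.induction_on with
  | C a => simp [polyDeriv_C, value]
  | add P Q hP hQ => simp_all [value]
  | mul_X P v hP =>
    have hX : value δ φ (polyDeriv δ n (X v)) = δ (value δ φ (X v)) := by
      rw [show v = (v.1, v.2) from rfl, polyDeriv_X]
      simp [value, Function.iterate_succ_apply']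
    simp only [value] at hP hX
    simp [value, Derivation.leibniz, hP, hX]

theorem iterate_polyDeriv_mem {δ : Derivation k R R} {n : ℕ} {G : Ideal (DiffPoly n R)}
    (hG : IsDifferentialIdeal δ G) {P : DiffPoly n R} (hP : P ∈ G) (j : ℕ) :
    (polyDeriv δ n)^[j] P ∈ G := by
  induction j with
  | zero => exact hP
  | succ j ih => rw [Function.iterate_succ_apply']; exact hG _ ih

theorem value_iterate_polyDeriv (δ : Derivation k R R) {n : ℕ} (φ : Fin n → R)
    (P : DiffPoly n R) (j : ℕ) :
    value δ φ ((polyDeriv δ n)^[j] P) = δ^[j] (value δ φ P) := by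
  induction j with
  | zero => rfl
  | succ j ih => rw [Function.iterate_succ_apply', Function.iterate_succ_apply', value_polyDeriv, ih]

end Value

section PowerSeries

variable {K : Type*} [Field K]

open PowerSeries (derivative)

theorem constantCoeff_value {n : ℕ} (φ : Fin n → PowerSeries K) (P : DiffPoly n (PowerSeries K)) :
    PowerSeries.constantCoeff (value (derivative K) φ P) =
      eval (fun v : Fin n × ℕ => (v.2.factorial : K) * PowerSeries.coeff v.2 (φ v.1))
        (map (PowerSeries.constantCoeff (R := K)) P) := by
  rw [value, eval_map, MvPolynomial.eval, coe_eval₂Hom, hom_eval₂, RingHom.comp_id]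
  congr 1
  funext v
  exact PowerSeries.constantCoeff_iterate_derivative _ _

/-- A tuple of power series solves a differential ideal as soon as all its values have constant
term zero. -/
theorem mem_Sol_of_constantCoeff_value [CharZero K] {n : ℕ}
    {G : Ideal (DiffPoly n (PowerSeries K))} (hG : IsDifferentialIdeal (derivative K) G)
    {φ : Fin n → PowerSeries K}
    (h : ∀ P ∈ G, PowerSeries.constantCoeff (value (derivative K) φ P) = 0) :
    φ ∈ Sol (derivative K) (G : Set (DiffPoly n (PowerSeries K))) := by
  intro P hP
  ext j
  -- The constant term of `(d^j P)(φ)` is `j!` times the `j`-th coefficient of `P(φ)`.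
  have := h _ (iterate_polyDeriv_mem hG hP j)
  rw [value_iterate_polyDeriv, PowerSeries.constantCoeff_iterate_derivative] at this
  simpa [Nat.factorial_ne_zero] using this

/-! ### Tropicalization -/

theorem coeff_tropPoly {n : ℕ} (P : DiffPoly n (PowerSeries K)) (M : Fin n × ℕ →₀ ℕ) :
    coeff M (tropPoly P) = Tropical.trop (PowerSeries.order (coeff M P)) := by
  classical
  simp only [tropPoly, coeff_sum, coeff_monomial, Finset.sum_ite_eq', mem_support_iff]
  split_ifs with h
  · rfl
  · rw [not_not.mp h, PowerSeries.order_zero, Tropical.trop_top]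

theorem support_tropPoly {n : ℕ} (P : DiffPoly n (PowerSeries K)) :
    (tropPoly P).support = P.support := by
  ext M
  rw [mem_support_iff, mem_support_iff, coeff_tropPoly, ← Tropical.trop_top, ne_eq,
    Tropical.trop_inj_iff, PowerSeries.order_eq_top]

theorem order_iterate_derivative [CharZero K] (φ : PowerSeries K) (j : ℕ) :
    ((derivative K)^[j] φ).order = Val (supp φ) j := by
  have hc : ∀ i, PowerSeries.coeff i ((derivative K)^[j] φ) ≠ 0 ↔ i + j ∈ supp φ := by
    intro i
    -- The factor `(i + 1)⋯(i + j)` is nonzero in characteristic zero.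
    rw [PowerSeries.coeff_iterate_derivative, supp, Set.mem_ofPred_eq, mul_ne_zero_iff,
      and_iff_right (Nat.cast_ne_zero.mpr (Nat.ascFactorial_pos i j).ne')]
  unfold Val
  split_ifs with h
  · have hmem := Nat.sInf_mem h
    rw [PowerSeries.order_eq_nat, hc, Nat.sub_add_cancel hmem.2]
    refine ⟨hmem.1, fun i hi => ?_⟩
    by_contra hne
    have : sInf (supp φ ∩ Set.Ici j) ≤ i + j :=
      Nat.sInf_le ⟨(hc i).mp hne, Nat.le_add_left j i⟩
    omega
  · rw [PowerSeries.order_eq_top]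
    ext i
    by_contra hne
    exact h ⟨i + j, (hc i).mp hne, Nat.le_add_left j i⟩

theorem termValue_tropPoly [CharZero K] {n : ℕ} (P : DiffPoly n (PowerSeries K))
    (φ : Fin n → PowerSeries K) (M : Fin n × ℕ →₀ ℕ) :
    termValue (tropPoly P) (tropTuple φ) M =
      (coeff M P * ∏ v ∈ M.support, (derivative K)^[v.2] (φ v.1) ^ M v).order := by
  rw [termValue, coeff_tropPoly, Tropical.untrop_trop, PowerSeries.order_mul,
    PowerSeries.order_prod, tropMonomialValue]
  simp only [PowerSeries.order_pow, order_iterate_derivative, nsmul_eq_mul, tropTuple]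

/-- If a sum of power series vanishes, the minimum of their orders is infinite or is attained
twice. -/
theorem exists_ne_order_eq_of_sum_eq_zero {ι : Type*} (s : Finset ι) (f : ι → PowerSeries K)
    (h : ∑ i ∈ s, f i = 0) (hinf : (s.inf fun i => (f i).order) ≠ ⊤) :
    ∃ i ∈ s, ∃ j ∈ s, i ≠ j ∧ (s.inf fun i => (f i).order) = (f i).order ∧
      (s.inf fun i => (f i).order) = (f j).order := by
  have hs : s.Nonempty := by
    rw [Finset.nonempty_iff_ne_empty]
    rintro rfl
    exact hinf Finset.inf_empty
  obtain ⟨i, hi, hmin⟩ := Finset.exists_mem_eq_inf s hs fun i => (f i).order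
  refine ⟨i, hi, ?_⟩
  by_contra! hcon
  obtain ⟨m, hm⟩ := ENat.ne_top_iff_exists.mp hinf
  -- If `i` alone attains the minimum `m`, no other summand contributes to the coefficient of `t^m`.
  have hlt : ∀ j ∈ s, j ≠ i → PowerSeries.coeff m (f j) = 0 := by
    intro j hj hji
    refine PowerSeries.coeff_of_lt_order m ?_
    rw [hm]
    exact (Finset.inf_le hj).lt_of_ne (hcon j hj hji.symm hmin)
  have h0 := congrArg (PowerSeries.coeff m) h
  rw [map_sum, Finset.sum_eq_single_of_mem i hi hlt, map_zero] at h0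
  exact (PowerSeries.order_eq_nat.mp (hmin.symm.trans hm.symm)).1 h0

theorem isTropSolution_tropTuple [CharZero K] {n : ℕ} {P : DiffPoly n (PowerSeries K)}
    {φ : Fin n → PowerSeries K} (h : value (derivative K) φ P = 0) :
    IsTropSolution (tropPoly P) (tropTuple φ) := by
  rw [value, eval_eq] at h
  by_cases hinf : tropValue (tropPoly P) (tropTuple φ) = ⊤
  · exact Or.inr hinf
  · left
    simp only [tropValue, termValue_tropPoly, support_tropPoly] at hinf ⊢
    exact exists_ne_order_eq_of_sum_eq_zero _ _ h hinf

theorem val_eq_zero_iff {S : Set ℕ} {j : ℕ} : Val S j = 0 ↔ j ∈ S := by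
  unfold Val
  split_ifs with h
  · have hmem := Nat.sInf_mem h
    rw [Nat.cast_eq_zero]
    constructor
    · intro h0
      have : sInf (S ∩ Set.Ici j) = j := by
        have : j ≤ sInf (S ∩ Set.Ici j) := hmem.2
        omega
      rw [this] at hmem
      exact hmem.1
    · intro hj
      have : sInf (S ∩ Set.Ici j) ≤ j := Nat.sInf_le ⟨hj, Set.self_mem_Ici⟩
      omega
  · exact iff_of_false (by simp) fun hj => h ⟨j, hj, Set.self_mem_Ici⟩

theorem tropMonomialValue_eq_zero_iff {n : ℕ} {S : Fin n → Set ℕ} {M : Fin n × ℕ →₀ ℕ} :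
    tropMonomialValue S M = 0 ↔ ∀ v ∈ M.support, v.2 ∈ S v.1 := by
  rw [tropMonomialValue, Finset.sum_eq_zero_iff]
  refine forall₂_congr fun v hv => ?_
  rw [mul_eq_zero, val_eq_zero_iff, Nat.cast_eq_zero,
    or_iff_right (Finsupp.mem_support_iff.mp hv)]

/-- Both summands in `ℕ∞` must vanish. This is the link between tropical values and reduction modulo
`t`. -/
theorem termValue_tropPoly_eq_zero_iff {n : ℕ} {P : DiffPoly n (PowerSeries K)}
    {S : Fin n → Set ℕ} {M : Fin n × ℕ →₀ ℕ} :
    termValue (tropPoly P) S M = 0 ↔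
      coeff M (map (PowerSeries.constantCoeff (R := K)) P) ≠ 0 ∧ ∀ v ∈ M.support, v.2 ∈ S v.1 := by
  rw [termValue, coeff_tropPoly, Tropical.untrop_trop, add_eq_zero, tropMonomialValue_eq_zero_iff,
    coeff_map, ne_eq, ← PowerSeries.order_ne_zero_iff_constCoeff_eq_zero, not_not]

/-- If the reduction modulo `t` of `P` involves exactly one monomial supported on `S`, then `S` is
not a solution of `trop(P)`. -/
theorem not_isTropSolution_of_unique {n : ℕ} {P : DiffPoly n (PowerSeries K)}
    {S : Fin n → Set ℕ} {M : Fin n × ℕ →₀ ℕ} (hM : ∀ v ∈ M.support, v.2 ∈ S v.1)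
    (hcoeff : coeff M (map (PowerSeries.constantCoeff (R := K)) P) ≠ 0)
    (huniq : ∀ N, N ≠ M → (∀ v ∈ N.support, v.2 ∈ S v.1) →
      coeff N (map (PowerSeries.constantCoeff (R := K)) P) = 0) :
    ¬ IsTropSolution (tropPoly P) S := by
  have hM0 : termValue (tropPoly P) S M = 0 := termValue_tropPoly_eq_zero_iff.mpr ⟨hcoeff, hM⟩
  have hmem : M ∈ (tropPoly P).support := by
    rw [support_tropPoly, mem_support_iff]
    intro h
    rw [coeff_map, h, map_zero] at hcoeff
    exact hcoeff rfl
  have hval : tropValue (tropPoly P) S = 0 :=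
    nonpos_iff_eq_zero.mp (hM0 ▸ Finset.inf_le hmem)
  have honly : ∀ N, tropValue (tropPoly P) S = termValue (tropPoly P) S N → N = M := by
    intro N hN
    by_contra hne
    obtain ⟨h₁, h₂⟩ := termValue_tropPoly_eq_zero_iff.mp (hN.symm.trans hval)
    exact h₁ (huniq N hne h₂)
  rintro (⟨M₁, -, M₂, -, hne, h₁, h₂⟩ | htop)
  · exact hne ((honly M₁ h₁).trans (honly M₂ h₂).symm)
  · simp [hval] at htop

end PowerSeries

end DiffTrop

theorem mainTheorem1 {K : Type*} [Field K] [IsAlgClosed K] [CharZero K] [Uncountable K]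
    {n : ℕ} (G : Ideal (DiffTrop.DiffPoly n (PowerSeries K)))
    (hG : DiffTrop.IsDifferentialIdeal (PowerSeries.derivative K) G) :
    DiffTrop.TropSol (DiffTrop.tropPoly '' (G : Set (DiffTrop.DiffPoly n (PowerSeries K)))) =
      DiffTrop.tropTuple ''
        DiffTrop.Sol (PowerSeries.derivative K)
          (G : Set (DiffTrop.DiffPoly n (PowerSeries K))) := by
  open MvPolynomial DiffTrop in
  apply Set.Subset.antisymm
  · intro S hS
    let U : Set (Fin n × ℕ) := {v | v.2 ∈ S v.1}
    let red : DiffPoly n (PowerSeries K) →+* MvPolynomial (Fin n × ℕ) K :=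
      map PowerSeries.constantCoeff
    have hred : Function.Surjective red :=
      map_surjective _ fun a => ⟨PowerSeries.C a, PowerSeries.constantCoeff_C a⟩
    obtain ⟨a, ha, haU⟩ := exists_zero_of_forall_monomial_notMem
      (G.map red ⊔ Ideal.span (X '' Uᶜ)) U fun M hM hmem => by
        obtain ⟨g, hg, r, hr, hgr⟩ := Submodule.mem_sup.mp hmem
        obtain ⟨P, hP, rfl⟩ := (Ideal.mem_map_iff_of_surjective red hred).mp hg
        have hr0 : ∀ N : Fin n × ℕ →₀ ℕ, (∀ v ∈ N.support, v.2 ∈ S v.1) → coeff N r = 0 := by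
          intro N hN
          by_contra hne
          obtain ⟨v, hv, hNv⟩ := mem_ideal_span_X_image.mp hr N (mem_support_iff.mpr hne)
          exact hv (hN v (Finsupp.mem_support_iff.mpr hNv))
        -- Elements of the ideal of the variables outside `U` have no monomial supported on `U`, so
        -- there `red P` agrees with the single monomial `M`.
        have hc : ∀ N : Fin n × ℕ →₀ ℕ, (∀ v ∈ N.support, v.2 ∈ S v.1) →
            coeff N (red P) = coeff N (monomial M (1 : K)) := by
          intro N hN
          rw [← hgr, coeff_add, hr0 N hN, add_zero]
        refine not_isTropSolution_of_unique (S := S) hM ?_ (fun N hne hN => ?_)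
          (hS _ ⟨P, hP, rfl⟩)
        · exact ne_of_eq_of_ne ((hc M hM).trans (by classical rw [coeff_monomial, if_pos rfl])) one_ne_zero
        · exact (hc N hN).trans (by classical rw [coeff_monomial, if_neg hne.symm])
    -- Dividing by `j!` makes `a (i, j)` the constant term of the `j`-th derivative of `φ i`.
    let φ : Fin n → PowerSeries K := fun i =>
      PowerSeries.mk fun j => (j.factorial : K)⁻¹ * a (i, j)
    refine ⟨φ, mem_Sol_of_constantCoeff_value hG fun P hP => ?_, ?_⟩
    · rw [constantCoeff_value]
      have : (fun v : Fin n × ℕ => (v.2.factorial : K) * PowerSeries.coeff v.2 (φ v.1)) = a := by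
        funext v
        simp [φ, Nat.factorial_ne_zero]
      rw [this]
      exact ha _ (Ideal.mem_sup_left (Ideal.mem_map_of_mem red hP))
    · funext i
      ext j
      have hsupp : j ∈ tropTuple φ i ↔ a (i, j) ≠ 0 := by
        simp [tropTuple, supp, φ, Nat.factorial_ne_zero]
      rw [hsupp]
      refine ⟨fun hne => ?_, haU (i, j)⟩
      by_contra hj
      have := ha (X (i, j)) (Ideal.mem_sup_right (Ideal.subset_span ⟨(i, j), hj, rfl⟩))
      exact hne (by simpa using this)
  · rintro _ ⟨φ, hφ, rfl⟩ _ ⟨P, hP, rfl⟩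
    exact isTropSolution_tropTuple (hφ P hP)
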